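/- Let $(X,d)$ be a finite ultrametric space with $|X|\ge 2$. Its spectrum is $\operatorname{Sp}(X)=\{d(x,y): x,y\in X\}$. Its representing tree $T_X$ is the labeled rooted tree whose root is the set $X$ and which is built as follows: each node is a nonempty subset $A\subseteq X$ with label $\operatorname{diam}A$; a node $A$ with $|A|=1$ has no children; the children of a node $A$ with $|A|\ge 2$ are the parts $A_1,\dots,A_k$ ($k\ge2$) of the diametrical graph of $A$, i.e. of the complete multipartite graph on the vertex set $A$ in which $x$ and $y$ are adjacent if and only if $d(x,y)=\operatorname{diam}A$. A node is internal if it has at least one child and a leaf otherwise; $\delta^+(v)$ denotes the number of children of $v$; the level $\operatorname{lev}(v)$ is the number of edges on the path from the root to $v$, and the height $h(T_X)$ is the largest level of a leaf. Suppose that the internal labeling of $T_X$ is injective, i.e. distinct internal nodes have distinct labels. Then the following statements are equivalent. (i) For every nonempty finite ultrametric space $(Y,\rho)$ such that $\operatorname{Sp}(Y)=\operatorname{Sp}(X)$ and such that $T_Y$ and $T_X$ are isomorphic as rooted trees (there is a graph isomorphism mapping root to root, labels being disregarded), the spaces $(X,d)$ and $(Y,\rho)$ are isometric. (ii) For all distinct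 internal nodes $u,v$ of $T_X$, the equality $\operatorname{lev}(u)=\operatorname{lev}(v)$ implies $\operatorname{lev}(u)=\operatorname{lev}(v)=h(T_X)-1$ and $\delta^+(u)=\delta^+(v)$. -/

import Mathlib

universe u

namespace UltraTree

/-! ### Rooted trees -/

/-- A rooted tree: a tree (in the sense of graph theory) with a distinguished vertex. -/
structure RTree where
  /-- the nodes -/
  V : Type u
  /-- the underlying graph -/
  graph : SimpleGraph V
  isTree : graph.IsTree
  /-- the root -/
  root : V

namespace RTree

variable (T : RTree.{u})

/-- The level of a node: its distance to the root. -/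
noncomputable def level (v : T.V) : ℕ := T.graph.dist T.root v

/-- `w` is a child (direct successor) of `v`: the two are adjacent and `w` is one level further
away from the root than `v`. -/
def IsChild (v w : T.V) : Prop := T.graph.Adj v w ∧ T.level w = T.level v + 1

/-- The out-degree of a node: the number of its children. -/
noncomputable def outDegree (v : T.V) : ℕ := {w : T.V | T.IsChild v w}.ncard

/-- A leaf is a node without children (so the root of a one-node tree is a leaf). -/
def IsLeaf (v : T.V) : Prop := ∀ w : T.V, ¬ T.IsChild v w

/-- An internal node is a node that is not a leaf. -/
def IsInternal (v : T.V) : Prop := ¬ T.IsLeaf v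

/-- The height of a (finite) rooted tree: the largest level of a leaf. -/
noncomputable def height : ℕ := sSup {n : ℕ | ∃ v : T.V, T.IsLeaf v ∧ T.level v = n}

/-- Two rooted trees are isomorphic if there is a graph isomorphism that maps root to root. -/
def Isomorphic (T₁ T₂ : RTree.{u}) : Prop :=
  ∃ f : T₁.graph ≃g T₂.graph, f T₁.root = T₂.root

end RTree

/-! ### The representing tree of a finite ultrametric space -/

section Representing

variable {X : Type u} [MetricSpace X]

/-- The diametrical graph of a subspace `A`: two points are adjacent if their distance is the
diameter of `A`. -/
def diametricalGraph (A : Set X) : SimpleGraph A where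
  Adj x y := x ≠ y ∧ dist x y = Metric.diam A
  symm := ⟨fun x y h => ⟨h.1.symm, by rw [dist_comm]; exact h.2⟩⟩
  loopless := ⟨fun _ h => h.1 rfl⟩

/-- `B` is one of the parts of the complete multipartite graph `diametricalGraph A`, where `A` has
at least two points: it consists of the points that are not adjacent to some given point `x`. -/
def IsPart (A B : Set X) : Prop :=
  A.Nontrivial ∧ ∃ x : A, B = Subtype.val '' {y : A | ¬ (diametricalGraph A).Adj x y}

/-- The nodes of the representing tree: the whole space is one, and the parts of the diametrical
graph of a node with at least two points are again nodes. -/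
inductive IsNode : Set X → Prop
  | root : IsNode Set.univ
  | part {A B : Set X} : IsNode A → IsPart A B → IsNode B

variable (X) in
/-- The type of nodes of the representing tree. -/
def Node : Type u := {A : Set X // IsNode A}

variable (X) in
/-- The graph of the representing tree: every node with at least two points is joined to the parts
of its diametrical graph. -/
def representingGraph : SimpleGraph (Node X) where
  Adj u v := u ≠ v ∧ (IsPart u.1 v.1 ∨ IsPart v.1 u.1)
  symm := ⟨fun _ _ h => ⟨h.1.symm, h.2.symm⟩⟩
  loopless := ⟨fun _ h => h.1 rfl⟩

/-- The label of a node is its diameter. -/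
noncomputable def label (v : Node X) : ℝ := Metric.diam v.1

variable (X) in
/-- The spectrum: the set of all distances. -/
def spectrum : Set ℝ := {t : ℝ | ∃ x y : X, dist x y = t}

theorem dist_le_diam [Finite X] {A : Set X} {x y : X} (hx : x ∈ A) (hy : y ∈ A) :
    dist x y ≤ Metric.diam A :=
  Metric.dist_le_diam_of_mem (Set.toFinite A).isBounded hx hy

theorem isCompleteMultipartite_diametricalGraph [IsUltrametricDist X] [Finite X] (A : Set X) :
    (diametricalGraph A).IsCompleteMultipartite := by
  refine ⟨fun x y z hxy hyz hxz => ?_⟩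
  have key : ∀ p q : A, ¬ (diametricalGraph A).Adj p q → p = q ∨ dist p q < Metric.diam A := by
    intro p q h
    by_cases hpq : p = q
    · exact Or.inl hpq
    · refine Or.inr (lt_of_le_of_ne (dist_le_diam p.2 q.2) fun h' => h ⟨hpq, h'⟩)
  rcases key x y hxy with rfl | h1
  · exact hyz hxz
  rcases key y z hyz with rfl | h2
  · exact hxy hxz
  have h3 := IsUltrametricDist.dist_triangle_max (x : X) y z
  have h4 : dist (x : X) z = Metric.diam A := hxz.2
  have h5 : dist (x : X) y < Metric.diam A := h1
  have h6 : dist (y : X) z < Metric.diam A := h2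
  exact absurd h3 (by rw [h4, not_le]; exact max_lt h5 h6)

theorem diam_pos [Finite X] {A : Set X} (hA : A.Nontrivial) : 0 < Metric.diam A := by
  obtain ⟨x, hx, y, hy, hxy⟩ := hA
  exact (dist_pos.2 hxy).trans_le (dist_le_diam hx hy)

theorem isPart_iff [Finite X] {A B : Set X} :
    IsPart A B ↔
      A.Nontrivial ∧ ∃ x ∈ A, B = {y | y ∈ A ∧ dist x y < Metric.diam A} := by
  refine and_congr_right fun hA => ?_
  have : ∀ x : A, Subtype.val '' {y : A | ¬ (diametricalGraph A).Adj x y} =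
      {y | y ∈ A ∧ dist (x : X) y < Metric.diam A} := by
    intro x
    ext y
    constructor
    · rintro ⟨y, hy, rfl⟩
      refine ⟨y.2, lt_of_le_of_ne (dist_le_diam x.2 y.2) fun h => hy ⟨?_, h⟩⟩
      rintro rfl
      have := diam_pos hA
      rw [← h] at this
      simp at this
    · rintro ⟨hy, h⟩
      exact ⟨⟨y, hy⟩, fun h' => h.ne h'.2, rfl⟩
  constructor
  · rintro ⟨x, rfl⟩
    exact ⟨x, x.2, this x⟩
  · rintro ⟨x, hx, rfl⟩
    exact ⟨⟨x, hx⟩, (this ⟨x, hx⟩).symm⟩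

theorem IsPart.diam_lt [IsUltrametricDist X] [Finite X] {A B : Set X} (h : IsPart A B) :
    Metric.diam B < Metric.diam A := by
  obtain ⟨hA, x, hx, rfl⟩ := isPart_iff.1 h
  have hpos := diam_pos hA
  set B := {y | y ∈ A ∧ dist x y < Metric.diam A} with hB
  have hne : B.Nonempty := ⟨x, hx, by simpa using hpos⟩
  obtain ⟨p, hp, hpmax⟩ := Set.exists_max_image (B ×ˢ B) (fun p => dist p.1 p.2)
    (Set.toFinite _) (hne.prod hne)
  have hlt : dist p.1 p.2 < Metric.diam A := by
    refine (IsUltrametricDist.dist_triangle_max p.1 x p.2).trans_lt (max_lt ?_ hp.2.2)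
    rw [dist_comm]
    exact hp.1.2
  refine lt_of_le_of_lt (Metric.diam_le_of_forall_dist_le dist_nonneg fun a ha b hb => ?_) hlt
  exact hpmax (a, b) ⟨ha, hb⟩

theorem IsNode.mem_of_dist_le [IsUltrametricDist X] [Finite X] {A : Set X} (h : IsNode A) :
    ∀ {x z : X}, x ∈ A → dist x z ≤ Metric.diam A → z ∈ A := by
  induction h with
  | root => intro x z _ _; trivial
  | part hA hAB ih =>
    intro x z hx hz
    have hlt := hAB.diam_lt
    obtain ⟨_, c, hc, rfl⟩ := isPart_iff.1 hAB
    refine ⟨ih hx.1 (hz.trans hlt.le), ?_⟩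
    exact (IsUltrametricDist.dist_triangle_max c x z).trans_lt
      (max_lt hx.2 (hz.trans_lt hlt))

theorem IsPart.parent_unique [IsUltrametricDist X] [Finite X] {A A' B : Set X}
    (hA : IsNode A) (hA' : IsNode A') (h : IsPart A B) (h' : IsPart A' B) : A = A' := by
  wlog hle : Metric.diam A ≤ Metric.diam A' generalizing A A'
  · exact (this hA' hA h' h (le_of_not_ge hle)).symm
  have hlt := h.diam_lt
  obtain ⟨hn, x, hx, hB⟩ := isPart_iff.1 h
  obtain ⟨hn', x', hx', hB'⟩ := isPart_iff.1 h'
  have hxB : x ∈ B := by rw [hB]; exact ⟨hx, by simpa using diam_pos hn⟩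
  have hxB' : x ∈ A' ∧ dist x' x < Metric.diam A' := by rw [hB'] at hxB; exact hxB
  have hsub : A ⊆ A' := fun y hy => hA'.mem_of_dist_le hxB'.1 ((dist_le_diam hx hy).trans hle)
  rcases hle.lt_or_eq with hl | he
  · have hAB : A ⊆ B := by
      intro y hy
      rw [hB']
      exact ⟨hsub hy, (IsUltrametricDist.dist_triangle_max x' x y).trans_lt
        (max_lt hxB'.2 ((dist_le_diam hx hy).trans_lt hl))⟩
    exact absurd (Metric.diam_mono hAB (Set.toFinite B).isBounded) (not_le.2 hlt)
  · refine hsub.antisymm fun y hy => hA.mem_of_dist_le hx ?_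
    rw [he]
    exact dist_le_diam hxB'.1 hy

theorem reachable_root [IsUltrametricDist X] [Finite X] {A : Set X} (h : IsNode A) :
    (representingGraph X).Reachable ⟨Set.univ, IsNode.root⟩ ⟨A, h⟩ := by
  induction h with
  | root => exact SimpleGraph.Reachable.refl _
  | part hA hAB ih =>
    refine ih.trans (SimpleGraph.Adj.reachable ⟨fun he => ?_, Or.inl hAB⟩)
    exact hAB.diam_lt.ne' (congrArg Metric.diam (congrArg Subtype.val he))

variable (X) in
theorem isTree_representingGraph [IsUltrametricDist X] [Finite X] :
    (representingGraph X).IsTree := by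
  have : Nonempty (Node X) := ⟨⟨Set.univ, IsNode.root⟩⟩
  have hmin : ∀ {u v : Node X}, (representingGraph X).Adj u v → label u ≤ label v →
      IsPart v.1 u.1 := by
    intro u v h hl
    rcases h.2 with h | h
    · exact absurd h.diam_lt (not_lt.2 hl)
    · exact h
  refine ⟨⟨fun u v => (reachable_root u.2).symm.trans (reachable_root v.2)⟩, ?_⟩
  classical
  intro v c hc
  obtain ⟨m, hm, hmin'⟩ := Set.exists_min_image {w | w ∈ c.support} label
    (List.finite_toSet c.support) ⟨v, c.start_mem_support⟩
  have hc' : (c.rotate m hm).IsCycle := hc.rotate hm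
  have hmem : ∀ w ∈ (c.rotate m hm).support, label m ≤ label w := by
    intro w hw
    apply hmin'
    simpa using hw
  have h1 := hmin ((c.rotate m hm).adj_snd hc'.not_nil) (hmem _ (SimpleGraph.Walk.getVert_mem_support _ _))
  have h2 := hmin ((c.rotate m hm).adj_penultimate hc'.not_nil).symm
    (hmem _ (SimpleGraph.Walk.getVert_mem_support _ _))
  exact hc'.snd_ne_penultimate (Subtype.ext
    (IsPart.parent_unique (c.rotate m hm).snd.2 (c.rotate m hm).penultimate.2 h1 h2))

variable (X) in
/-- The representing tree `T_X` of a finite ultrametric space, rooted at the whole space. -/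
def representingTree [IsUltrametricDist X] [Finite X] : RTree.{u} where
  V := Node X
  graph := representingGraph X
  isTree := isTree_representingGraph X
  root := ⟨Set.univ, IsNode.root⟩

variable (X) in
/-- The internal labeling of `T_X` (the restriction of the labeling to the internal nodes) is
injective. -/
def InjectiveInternalLabeling [IsUltrametricDist X] [Finite X] : Prop :=
  Set.InjOn (label : Node X → ℝ) {v : Node X | (representingTree X).IsInternal v}

variable (X) in
/-- `X` is tree-spectrum isometric: every finite ultrametric space with the same spectrum and an
isomorphic representing tree is isometric to `X`. -/
def TreeSpectrumIsometric [IsUltrametricDist X] [Finite X] : Prop :=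
  ∀ (Y : Type u) [MetricSpace Y] [IsUltrametricDist Y] [Finite Y] [Nonempty Y],
    (representingTree X).Isomorphic (representingTree Y) → spectrum X = spectrum Y →
      Nonempty (X ≃ᵢ Y)

end Representing

end UltraTree

/-! The distance of two points is the label of the smallest node containing both (`join`). So a
space is determined by its tree and labels, and the internal labels are exactly the nonzero elements
of the spectrum.

(i) ⇒ (ii): labels may be permuted among internal nodes as long as they decrease from level to
level; this keeps the tree and the spectrum (`IsLevelRelabeling.exists_space`). One such relabeling
comes from sorting, another from composing it with a swap of two internal nodes of equal level. By
(i) both spaces are isometric to `X`, and as labels are distinct, the resulting tree automorphism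
acts on internal nodes as that swap (`TreeSpectrumIsometric.exists_swap`). Hence the swapped nodes
have equal out-degree. If their level had internal nodes below it, some swap would move the parent
of an internal node while fixing that node, which is absurd.

(ii) ⇒ (i): condition (ii) passes to `Y`, and equal labels give a bijection `lam` of internal nodes.
Under (ii) labels decrease with the level, so counting nodes per level shows that `lam` preserves
levels, hence inclusions. It also preserves the number of leaf children, so it lifts to a bijection
of points, which is an isometry (`dist_map_le` in both directions). -/

namespace UltraTree

/-! ### Invariance under isomorphisms of rooted trees. -/

namespace RTree

/-- At each level there is at most one internal node, except possibly at the last level that has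
internal nodes, where all of them have the same out-degree. -/
def LevelRigid (T : RTree.{u}) : Prop :=
  ∀ v w : T.V, T.IsInternal v → T.IsInternal w → v ≠ w → T.level v = T.level w →
    T.level v + 1 = T.height ∧ T.level w + 1 = T.height ∧ T.outDegree v = T.outDegree w

variable {T₁ T₂ : RTree.{u}} (f : T₁.graph ≃g T₂.graph) (hf : f T₁.root = T₂.root)
include hf

theorem level_map (v : T₁.V) : T₂.level (f v) = T₁.level v := by
  have key : ∀ {S₁ S₂ : RTree.{u}} (g : S₁.graph ≃g S₂.graph), g S₁.root = S₂.root →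
      ∀ v, S₂.level (g v) ≤ S₁.level v := by
    intro S₁ S₂ g hg v
    obtain ⟨p, hp⟩ := S₁.isTree.connected.exists_walk_length_eq_dist S₁.root v
    have := SimpleGraph.dist_le (p.map g.toHom)
    rw [SimpleGraph.Walk.length_map, hp] at this
    unfold level
    rw [← hg]
    exact this
  refine le_antisymm (key f hf v) ?_
  have := key f.symm (by rw [← hf]; exact f.symm_apply_apply _) (f v)
  rwa [show f.symm (f v) = v from f.symm_apply_apply v] at this

theorem isChild_map {v w : T₁.V} : T₂.IsChild (f v) (f w) ↔ T₁.IsChild v w := by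
  unfold IsChild
  rw [level_map f hf, level_map f hf, f.map_adj_iff]

theorem isLeaf_map {v : T₁.V} : T₂.IsLeaf (f v) ↔ T₁.IsLeaf v := by
  unfold IsLeaf
  rw [← f.toEquiv.forall_congr_right]
  exact forall_congr' fun w => not_congr (isChild_map f hf)

theorem isInternal_map {v : T₁.V} : T₂.IsInternal (f v) ↔ T₁.IsInternal v :=
  not_congr (isLeaf_map f hf)

theorem outDegree_map (v : T₁.V) : T₂.outDegree (f v) = T₁.outDegree v := by
  unfold outDegree
  rw [← Set.ncard_image_of_injective _ f.injective]
  congr 1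
  ext w
  obtain ⟨w, rfl⟩ := f.surjective w
  simp [isChild_map f hf]

theorem height_map : T₂.height = T₁.height := by
  unfold height
  congr 1
  ext n
  constructor
  · rintro ⟨v, hv, rfl⟩
    obtain ⟨v, rfl⟩ := f.surjective v
    exact ⟨v, (isLeaf_map f hf).1 hv, (level_map f hf v).symm⟩
  · rintro ⟨v, hv, rfl⟩
    exact ⟨f v, (isLeaf_map f hf).2 hv, level_map f hf v⟩

theorem LevelRigid.map (h : T₁.LevelRigid) : T₂.LevelRigid := by
  intro v w hv hw hne hl
  obtain ⟨v, rfl⟩ := f.surjective v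
  obtain ⟨w, rfl⟩ := f.surjective w
  rw [isInternal_map f hf] at hv hw
  rw [level_map f hf, level_map f hf] at *
  rw [height_map f hf, outDegree_map f hf, outDegree_map f hf]
  exact h v w hv hw (fun e => hne (congrArg f e)) hl

end RTree

/-! ### Nodes as balls, smallest common nodes, levels and height. -/

section Nodes

variable {X : Type u} [MetricSpace X] [IsUltrametricDist X] [Finite X]

instance : Finite (Node X) := inferInstanceAs (Finite {A : Set X // IsNode A})

/-- A point farthest from `x` works: any two points of `A` are within the larger of their distances
to `x`. -/
theorem exists_dist_eq_diam {A : Set X} {x : X} (hx : x ∈ A) :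
    ∃ y ∈ A, dist x y = Metric.diam A := by
  obtain ⟨y, hy, hmax⟩ := Set.exists_max_image A (dist x) (Set.toFinite A) ⟨x, hx⟩
  refine ⟨y, hy, le_antisymm (dist_le_diam hx hy) ?_⟩
  refine Metric.diam_le_of_forall_dist_le dist_nonneg fun a ha b hb => ?_
  refine (IsUltrametricDist.dist_triangle_max a x b).trans (max_le ?_ (hmax b hb))
  rw [dist_comm]
  exact hmax a ha

/-- Being a part only depends on the comparison of distances from a common point. -/
theorem isPart_iff_exists_lt {A B : Set X} :
    IsPart A B ↔
      A.Nontrivial ∧ ∃ x ∈ A, B = {y | y ∈ A ∧ ∃ z ∈ A, dist x y < dist x z} := by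
  rw [isPart_iff]
  refine and_congr_right fun _ => exists_congr fun x => and_congr_right fun hx => ?_
  have : {y | y ∈ A ∧ dist x y < Metric.diam A} =
      {y | y ∈ A ∧ ∃ z ∈ A, dist x y < dist x z} := by
    ext y
    refine and_congr_right fun hy => ⟨fun h => ?_, fun ⟨z, hz, h⟩ => h.trans_le (dist_le_diam hx hz)⟩
    obtain ⟨z, hz, h'⟩ := exists_dist_eq_diam hx
    exact ⟨z, hz, h' ▸ h⟩
  rw [this]

omit [IsUltrametricDist X] in
theorem IsNode.nonempty [Nonempty X] {A : Set X} (hA : IsNode A) : A.Nonempty := by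
  induction hA with
  | root => exact Set.univ_nonempty
  | part _ h _ =>
    obtain ⟨hn, x, hx, rfl⟩ := isPart_iff.1 h
    exact ⟨x, hx, by simpa using diam_pos hn⟩

theorem IsPart.ssubset {A B : Set X} (h : IsPart A B) : B ⊂ A := by
  refine Set.ssubset_iff_subset_ne.2 ⟨?_, fun e => h.diam_lt.ne (by rw [e])⟩
  obtain ⟨_, x, hx, rfl⟩ := isPart_iff.1 h
  exact fun y hy => hy.1

omit [IsUltrametricDist X] in
theorem exists_isPart_mem {A : Set X} (hA : A.Nontrivial) {x : X} (hx : x ∈ A) :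
    ∃ B, IsPart A B ∧ x ∈ B ∧ ∀ y ∈ A, dist x y < Metric.diam A → y ∈ B :=
  ⟨_, isPart_iff.2 ⟨hA, x, hx, rfl⟩, ⟨hx, by simpa using diam_pos hA⟩, fun _ hy h => ⟨hy, h⟩⟩

theorem IsNode.subset_of_diam_le {A B : Set X} (hB : IsNode B) {x : X} (hxA : x ∈ A) (hxB : x ∈ B)
    (h : Metric.diam A ≤ Metric.diam B) : A ⊆ B :=
  fun _ hy => hB.mem_of_dist_le hxB ((dist_le_diam hxA hy).trans h)

theorem IsNode.eq_of_diam_eq {A B : Set X} (hA : IsNode A) (hB : IsNode B) {x : X} (hxA : x ∈ A)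
    (hxB : x ∈ B) (h : Metric.diam A = Metric.diam B) : A = B :=
  (hB.subset_of_diam_le hxA hxB h.le).antisymm (hA.subset_of_diam_le hxB hxA h.ge)

/-- Take a node of least diameter containing both points. Were its diameter larger than their
distance, one of its parts would contain both. -/
theorem exists_isNode_diam_eq (x y : X) :
    ∃ A : Set X, IsNode A ∧ x ∈ A ∧ y ∈ A ∧ Metric.diam A = dist x y := by
  obtain ⟨A, ⟨hA, hx, hy⟩, hmin⟩ := Set.exists_min_image {A : Set X | IsNode A ∧ x ∈ A ∧ y ∈ A}
    Metric.diam (Set.toFinite _) ⟨Set.univ, IsNode.root, trivial, trivial⟩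
  refine ⟨A, hA, hx, hy, (dist_le_diam hx hy).eq_of_not_lt' fun hlt => ?_⟩
  have hn : A.Nontrivial := by
    by_contra h
    rw [Metric.diam_subsingleton (Set.not_nontrivial_iff.1 h)] at hlt
    exact hlt.not_ge dist_nonneg
  obtain ⟨B, hB, hxB, hB'⟩ := exists_isPart_mem hn hx
  exact hB.diam_lt.not_ge (hmin B ⟨hA.part hB, hxB, hB' y hy hlt⟩)

theorem isNode_closedBall (x y : X) : IsNode (Metric.closedBall x (dist x y)) := by
  obtain ⟨A, hA, hx, hy, h⟩ := exists_isNode_diam_eq x y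
  convert hA using 1
  ext z
  rw [Metric.mem_closedBall, dist_comm, ← h]
  exact ⟨hA.mem_of_dist_le hx, dist_le_diam hx⟩

theorem diam_closedBall_dist (x y : X) : Metric.diam (Metric.closedBall x (dist x y)) = dist x y := by
  obtain ⟨A, hA, hx, hy, h⟩ := exists_isNode_diam_eq x y
  rw [← h]
  congr 1
  ext z
  rw [Metric.mem_closedBall, dist_comm]
  exact ⟨hA.mem_of_dist_le hx, dist_le_diam hx⟩

/-- The smallest node containing two given points. -/
def join (x y : X) : Node X := ⟨Metric.closedBall x (dist x y), isNode_closedBall x y⟩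

theorem label_join (x y : X) : label (join x y) = dist x y := diam_closedBall_dist x y

theorem left_mem_join (x y : X) : x ∈ (join x y).1 := Metric.mem_closedBall_self dist_nonneg

theorem right_mem_join (x y : X) : y ∈ (join x y).1 := by
  simp [join, dist_comm]

theorem Node.subset_of_label_le {v w : Node X} {x : X} (hv : x ∈ v.1) (hw : x ∈ w.1)
    (h : label v ≤ label w) : v.1 ⊆ w.1 := w.2.subset_of_diam_le hv hw h

theorem Node.eq_of_label_eq {v w : Node X} {x : X} (hv : x ∈ v.1) (hw : x ∈ w.1)
    (h : label v = label w) : v = w := Subtype.ext (v.2.eq_of_diam_eq w.2 hv hw h)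

theorem join_comm (x y : X) : join x y = join y x :=
  Node.eq_of_label_eq (left_mem_join x y) (right_mem_join y x)
    (by rw [label_join, label_join, dist_comm])

theorem coe_join_self (x : X) : (join x x).1 = {x} := by simp [join]

theorem exists_join_eq {v : Node X} {x : X} (hx : x ∈ v.1) : ∃ y ∈ v.1, join x y = v := by
  obtain ⟨y, hy, h⟩ := exists_dist_eq_diam hx
  exact ⟨y, hy, Node.eq_of_label_eq (left_mem_join x y) hx (by rw [label_join, h]; rfl)⟩

theorem nontrivial_join_iff {x y : X} : (join x y).1.Nontrivial ↔ x ≠ y := by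
  constructor
  · rintro h rfl
    rw [coe_join_self] at h
    exact Set.not_nontrivial_singleton h
  · exact fun h => ⟨x, left_mem_join x y, y, right_mem_join x y, h⟩

omit [IsUltrametricDist X] in
theorem label_pos {v : Node X} (h : v.1.Nontrivial) : 0 < label v := diam_pos h

omit [IsUltrametricDist X] [Finite X] in
theorem label_eq_zero {v : Node X} (h : ¬ v.1.Nontrivial) : label v = 0 :=
  Metric.diam_subsingleton (Set.not_nontrivial_iff.1 h)

theorem range_label [Nonempty X] : Set.range (label : Node X → ℝ) = spectrum X := by
  ext t
  constructor
  · rintro ⟨v, rfl⟩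
    obtain ⟨x, hx⟩ := v.2.nonempty
    obtain ⟨y, -, rfl⟩ := exists_join_eq hx
    exact ⟨x, y, (label_join x y).symm⟩
  · rintro ⟨x, y, rfl⟩
    exact ⟨join x y, label_join x y⟩

/-- No node lies strictly between a node and one of its parts: a node of smaller diameter than `v`
that meets the part is contained in it. -/
theorem IsPart.label_le_of_ssubset [Nonempty X] {v w c : Node X} (h : IsPart v.1 w.1)
    (hc : w.1 ⊂ c.1) : label v ≤ label c := by
  obtain ⟨x, hx⟩ := w.2.nonempty
  by_contra hlt
  push Not at hlt
  obtain ⟨hn, y, hy, hw⟩ := isPart_iff.1 h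
  refine hc.not_subset fun z hz => ?_
  have hxw := hx
  rw [hw] at hxw ⊢
  refine ⟨Node.subset_of_label_le (hc.subset hx) hxw.1 hlt.le hz, ?_⟩
  exact (IsUltrametricDist.dist_triangle_max y x z).trans_lt
    (max_lt hxw.2 ((dist_le_diam (hc.subset hx) hz).trans_lt hlt))

/-- The number of nodes strictly above a node; this is the level, by `level_eq_depth`. -/
noncomputable def depth (v : Node X) : ℕ := {w : Node X | v.1 ⊂ w.1}.ncard

theorem depth_eq_add_one [Nonempty X] {v w : Node X} (h : IsPart v.1 w.1) :
    depth w = depth v + 1 := by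
  unfold depth
  rw [← Set.ncard_insert_of_notMem (a := v) (by simp) (Set.toFinite _)]
  congr 1
  ext c
  simp only [Set.mem_ofPred_eq, Set.mem_insert_iff]
  constructor
  · intro hc
    obtain ⟨x, hx⟩ := w.2.nonempty
    have hle := h.label_le_of_ssubset hc
    rcases eq_or_ne c v with e | e
    · exact Or.inl e
    · refine Or.inr (Set.ssubset_iff_subset_ne.2 ⟨?_, fun e' => e (Subtype.ext e'.symm)⟩)
      exact Node.subset_of_label_le (h.ssubset.subset hx) (hc.subset hx) hle
  · rintro (rfl | hc)
    · exact h.ssubset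
    · exact h.ssubset.trans hc

omit [IsUltrametricDist X] [Finite X] in
theorem depth_root : depth (⟨Set.univ, IsNode.root⟩ : Node X) = 0 := by
  unfold depth
  convert Set.ncard_empty (Node X)
  ext w
  simpa using fun h : Set.univ ⊂ w.1 => h.not_subset (Set.subset_univ _)

theorem level_eq_depth [Nonempty X] (v : Node X) : (representingTree X).level v = depth v := by
  apply le_antisymm
  · obtain ⟨A, hA⟩ := v
    induction hA with
    | root => rw [depth_root]; exact (SimpleGraph.dist_self).le
    | part hA h ih =>
      have hadj : (representingGraph X).Adj ⟨_, hA⟩ ⟨_, hA.part h⟩ :=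
        ⟨fun e => h.ssubset.ne (congrArg Subtype.val e).symm, Or.inl h⟩
      rw [depth_eq_add_one (v := ⟨_, hA⟩) (w := ⟨_, hA.part h⟩) h]
      refine (isTree_representingGraph X).connected.dist_triangle.trans (Nat.add_le_add ih ?_)
      exact (SimpleGraph.dist_eq_one_iff_adj.2 hadj).le
  -- Every edge changes the depth by exactly one, so a walk from the root needs at least `depth v`
  -- edges.
  · have key : ∀ {a b : Node X} (p : (representingGraph X).Walk a b),
        depth b ≤ depth a + p.length := by
      intro a b p
      induction p with
      | nil => simp
      | cons h p ih =>
        rw [SimpleGraph.Walk.length_cons]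
        rcases h.2 with h | h
        · have := depth_eq_add_one h
          omega
        · have := depth_eq_add_one h
          omega
    obtain ⟨p, hp⟩ := (isTree_representingGraph X).connected.exists_walk_length_eq_dist
      ⟨Set.univ, IsNode.root⟩ v
    have := key p
    rw [depth_root, hp, zero_add] at this
    exact this

theorem level_eq_add_one [Nonempty X] {v w : Node X} (h : IsPart v.1 w.1) :
    (representingTree X).level w = (representingTree X).level v + 1 := by
  rw [level_eq_depth, level_eq_depth, depth_eq_add_one h]

theorem level_lt_of_ssubset [Nonempty X] {v w : Node X} (h : w.1 ⊂ v.1) :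
    (representingTree X).level v < (representingTree X).level w := by
  rw [level_eq_depth, level_eq_depth]
  refine Set.ncard_lt_ncard ?_ (Set.toFinite _)
  exact ⟨fun c hc => h.trans hc, fun h' => ssubset_irrefl v.1 (h' (a := v) h)⟩

theorem isChild_iff [Nonempty X] {v w : Node X} :
    (representingTree X).IsChild v w ↔ IsPart v.1 w.1 := by
  constructor
  · rintro ⟨⟨_, h | h⟩, hl⟩
    · exact h
    · have := level_eq_add_one h
      omega
  · exact fun h => ⟨⟨fun e => h.ssubset.ne (congrArg Subtype.val e).symm, Or.inl h⟩,
      level_eq_add_one h⟩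

theorem isInternal_iff [Nonempty X] {v : Node X} :
    (representingTree X).IsInternal v ↔ v.1.Nontrivial := by
  unfold RTree.IsInternal RTree.IsLeaf
  push Not
  constructor
  · rintro ⟨w, hw⟩
    exact (isChild_iff.1 hw).1
  · intro h
    obtain ⟨x, hx⟩ := h.nonempty
    obtain ⟨B, hB, -⟩ := exists_isPart_mem h hx
    exact ⟨(⟨B, v.2.part hB⟩ : Node X), isChild_iff.2 hB⟩

theorem isLeaf_iff [Nonempty X] {v : Node X} :
    (representingTree X).IsLeaf v ↔ ∃ x, v = join x x := by
  rw [← not_iff_not]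
  change (representingTree X).IsInternal v ↔ _
  rw [isInternal_iff, iff_not_comm, Set.not_nontrivial_iff]
  constructor
  · rintro ⟨x, rfl⟩
    rw [coe_join_self]
    exact Set.subsingleton_singleton
  · intro h
    obtain ⟨x, hx⟩ := v.2.nonempty
    exact ⟨x, Subtype.ext (by rw [coe_join_self]; exact h.eq_singleton_of_mem hx)⟩

theorem isLeaf_join_self [Nonempty X] (x : X) : (representingTree X).IsLeaf (join x x) :=
  isLeaf_iff.2 ⟨x, rfl⟩

theorem level_root [Nonempty X] :
    (representingTree X).level (⟨Set.univ, IsNode.root⟩ : Node X) = 0 :=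
  SimpleGraph.dist_self

theorem exists_parent [Nonempty X] {v : Node X} (hv : (representingTree X).level v ≠ 0) :
    ∃ w : Node X, IsPart w.1 v.1 := by
  obtain ⟨A, hA⟩ := v
  cases hA with
  | root => exact absurd level_root hv
  | part hA h => exact ⟨⟨_, hA⟩, h⟩

theorem exists_ancestor [Nonempty X] (v : Node X) {k : ℕ} (hk : k ≤ (representingTree X).level v) :
    ∃ w : Node X, (representingTree X).level w = k ∧ v.1 ⊆ w.1 := by
  obtain ⟨A, hA⟩ := v
  induction hA with
  | root =>
    refine ⟨_, ?_, subset_rfl⟩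
    have h0 := level_root (X := X)
    omega
  | part hA h ih =>
    have hl := level_eq_add_one (v := ⟨_, hA⟩) (w := ⟨_, hA.part h⟩) h
    rcases hk.lt_or_eq with hlt | rfl
    · obtain ⟨w, hw, hs⟩ := ih (by omega)
      exact ⟨w, hw, h.ssubset.subset.trans hs⟩
    · exact ⟨_, rfl, subset_rfl⟩

theorem exists_internal_ancestor [Nonempty X] (v : Node X) {k : ℕ}
    (hk : k < (representingTree X).level v) :
    ∃ w : Node X, (representingTree X).level w = k ∧ v.1 ⊂ w.1 ∧
      (representingTree X).IsInternal w := by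
  obtain ⟨w, hw, hs⟩ := exists_ancestor v hk.le
  have hss : v.1 ⊂ w.1 := Set.ssubset_iff_subset_ne.2 ⟨hs, fun e => by
    rw [← hw, Subtype.ext e] at hk
    exact hk.ne rfl⟩
  refine ⟨w, hw, hss, isInternal_iff.2 ?_⟩
  obtain ⟨x, hx⟩ := v.2.nonempty
  obtain ⟨y, hy, hyv⟩ := Set.exists_of_ssubset hss
  exact ⟨x, hs hx, y, hy, fun e => hyv (e ▸ hx)⟩

-- `height` is an `sSup` in `ℕ`, which would default to 0 on an unbounded set.
variable (X) in
theorem bddAbove_level_leaf : BddAbove {n : ℕ | ∃ v : (representingTree X).V,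
    (representingTree X).IsLeaf v ∧ (representingTree X).level v = n} := by
  refine (Set.Finite.subset (Set.finite_range fun v : Node X => (representingTree X).level v)
    ?_).bddAbove
  rintro n ⟨v, -, rfl⟩
  exact ⟨v, rfl⟩

theorem level_lt_height [Nonempty X] {v : Node X} (hv : (representingTree X).IsInternal v) :
    (representingTree X).level v < (representingTree X).height := by
  have hn := isInternal_iff.1 hv
  obtain ⟨x, hx⟩ := hn.nonempty
  refine lt_of_lt_of_le (level_lt_of_ssubset (w := join x x) ?_)
    (le_csSup (bddAbove_level_leaf X) ⟨join x x, isLeaf_join_self x, rfl⟩)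
  rw [coe_join_self]
  exact Set.ssubset_iff_subset_ne.2 ⟨by simpa using hx, fun e => by
    rw [← e] at hn
    exact Set.not_nontrivial_singleton hn⟩

variable (X) in
theorem exists_leaf_level_eq_height [Nonempty X] : ∃ v : Node X,
    (representingTree X).IsLeaf v ∧ (representingTree X).level v = (representingTree X).height := by
  obtain ⟨x⟩ := id ‹Nonempty X›
  exact Nat.sSup_mem (s := {n : ℕ | ∃ v : (representingTree X).V,
    (representingTree X).IsLeaf v ∧ (representingTree X).level v = n})
    ⟨_, join x x, isLeaf_join_self x, rfl⟩ (bddAbove_level_leaf X)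

end Nodes

end UltraTree

namespace UltraTree

/-! ### Bijections that induce isomorphisms of representing trees. -/

section LocalOrder

variable {X Y : Type u} [MetricSpace X] [IsUltrametricDist X] [Finite X]
  [MetricSpace Y] [IsUltrametricDist Y] [Finite Y]

/-- A bijection that preserves comparisons between distances from a common point. -/
def PreservesLocalOrder (ψ : X ≃ Y) : Prop :=
  ∀ x y z, dist (ψ x) (ψ y) < dist (ψ x) (ψ z) ↔ dist x y < dist x z

variable {ψ : X ≃ Y}

omit [IsUltrametricDist X] [Finite X] [IsUltrametricDist Y] [Finite Y] in
theorem PreservesLocalOrder.symm (h : PreservesLocalOrder ψ) : PreservesLocalOrder ψ.symm := by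
  intro x y z
  simpa using (h (ψ.symm x) (ψ.symm y) (ψ.symm z)).symm

/-- The form of parts in `isPart_iff_exists_lt` mentions no diameter, only comparisons from a common
point. -/
theorem PreservesLocalOrder.isPart (h : PreservesLocalOrder ψ) {A B : Set X} (hAB : IsPart A B) :
    IsPart (ψ '' A) (ψ '' B) := by
  rw [isPart_iff_exists_lt] at *
  obtain ⟨hA, x, hx, rfl⟩ := hAB
  refine ⟨hA.image ψ.injective, ψ x, Set.mem_image_of_mem _ hx, ?_⟩
  ext y
  obtain ⟨y, rfl⟩ := ψ.surjective y
  rw [ψ.injective.mem_set_image]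
  simp only [Set.mem_ofPred_eq, ψ.injective.mem_set_image, Set.exists_mem_image, h x]

theorem PreservesLocalOrder.isNode (h : PreservesLocalOrder ψ) {A : Set X} (hA : IsNode A) :
    IsNode (ψ '' A) := by
  induction hA with
  | root => rw [Set.image_univ_of_surjective ψ.surjective]; exact IsNode.root
  | part _ hAB ih => exact ih.part (h.isPart hAB)

/-- The bijection between the nodes induced by a bijection that preserves the local order. -/
def PreservesLocalOrder.nodeEquiv (h : PreservesLocalOrder ψ) : Node X ≃ Node Y where
  toFun v := ⟨ψ '' v.1, h.isNode v.2⟩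
  invFun v := ⟨ψ.symm '' v.1, h.symm.isNode v.2⟩
  left_inv v := Subtype.ext (by simp)
  right_inv v := Subtype.ext (by simp)

theorem PreservesLocalOrder.isPart_iff (h : PreservesLocalOrder ψ) {v w : Node X} :
    IsPart (h.nodeEquiv v).1 (h.nodeEquiv w).1 ↔ IsPart v.1 w.1 := by
  refine ⟨fun h' => ?_, h.isPart⟩
  have := h.symm.isPart h'
  have himage : ∀ c : Node X, ψ.symm '' (h.nodeEquiv c).1 = c.1 := fun c =>
    ψ.symm_image_image c.1
  rwa [himage, himage] at this

/-- The isomorphism of representing trees induced by a bijection that preserves the local order. -/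
def PreservesLocalOrder.treeIso (h : PreservesLocalOrder ψ) :
    (representingTree X).graph ≃g (representingTree Y).graph where
  toEquiv := h.nodeEquiv
  map_rel_iff' := by
    intro v w
    exact and_congr h.nodeEquiv.injective.ne_iff (or_congr h.isPart_iff h.isPart_iff)

theorem PreservesLocalOrder.treeIso_root (h : PreservesLocalOrder ψ) :
    h.treeIso (representingTree X).root = (representingTree Y).root :=
  Subtype.ext (Set.image_univ_of_surjective ψ.surjective)

theorem PreservesLocalOrder.isomorphic (h : PreservesLocalOrder ψ) :
    (representingTree X).Isomorphic (representingTree Y) := ⟨h.treeIso, h.treeIso_root⟩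

theorem PreservesLocalOrder.nodeEquiv_join (h : PreservesLocalOrder ψ) (x y : X) :
    h.nodeEquiv (join x y) = join (ψ x) (ψ y) := by
  refine Subtype.ext ?_
  change ψ '' Metric.closedBall x (dist x y) = Metric.closedBall (ψ x) (dist (ψ x) (ψ y))
  ext z
  obtain ⟨z, rfl⟩ := ψ.surjective z
  rw [ψ.injective.mem_set_image, Metric.mem_closedBall, Metric.mem_closedBall, dist_comm z,
    dist_comm (ψ z), ← not_lt, ← not_lt, h]

end LocalOrder

/-- A finite type with a real labeling has a permutation that makes the labels decrease along a
given rank function. -/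
theorem exists_perm_antitone {I : Type*} [Finite I] {f : I → ℝ} (hf : Function.Injective f)
    (p : I → ℕ) : ∃ σ : Equiv.Perm I, ∀ a b, p a < p b → f (σ b) < f (σ a) := by
  obtain ⟨n, ⟨e⟩⟩ := Finite.exists_equiv_fin I
  let τ₁ := Tuple.sort (f ∘ e.symm)
  let τ₂ := Tuple.sort (fun i => OrderDual.toDual (p (e.symm i)))
  have h₁ : StrictMono (fun i => f (e.symm (τ₁ i))) :=
    (Tuple.monotone_sort (f ∘ e.symm)).strictMono_of_injective
      ((hf.comp e.symm.injective).comp τ₁.injective)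
  have h₂ : Antitone (fun i => p (e.symm (τ₂ i))) :=
    fun i j hij => Tuple.monotone_sort (fun i => OrderDual.toDual (p (e.symm i))) hij
  -- The i-th element in order of decreasing rank is sent to the element with the i-th smallest
  -- label.
  refine ⟨e.trans (τ₂.symm.trans (τ₁.trans e.symm)), fun a b hab => ?_⟩
  refine h₁ (lt_of_not_ge fun hle => ?_)
  have := h₂ hle
  simp only [Equiv.apply_symm_apply, Equiv.symm_apply_apply] at this
  omega

/-! ### Necessity of the level condition, by relabeling. -/

section Relabel

variable {X : Type u} [MetricSpace X] [IsUltrametricDist X] [Finite X]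

/-- A permutation of the nodes is a level relabeling if it preserves internal nodes and moving the
labels along it makes them decrease from each level to the next. -/
structure IsLevelRelabeling (π : Equiv.Perm (Node X)) : Prop where
  nontrivial_iff : ∀ v, (π v).1.Nontrivial ↔ v.1.Nontrivial
  label_lt : ∀ v w : Node X, v.1.Nontrivial → w.1.Nontrivial →
    (representingTree X).level v < (representingTree X).level w → label (π w) < label (π v)

/-- The original labels decrease along branches but need not decrease from level to level across
branches. Sorting repairs this, and injectivity makes the decrease strict. -/
theorem exists_isLevelRelabeling [Nonempty X] (hinj : InjectiveInternalLabeling X) :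
    ∃ π : Equiv.Perm (Node X), IsLevelRelabeling π := by
  classical
  have hinj' : Function.Injective (fun v : {v : Node X // v.1.Nontrivial} => label v.1) := by
    intro v w h
    exact Subtype.ext (hinj (isInternal_iff.2 v.2) (isInternal_iff.2 w.2) h)
  obtain ⟨σ, hσ⟩ := exists_perm_antitone hinj' fun v => (representingTree X).level v.1
  have hmem : ∀ v : Node X, ∀ hv : v.1.Nontrivial, Equiv.Perm.ofSubtype σ v = (σ ⟨v, hv⟩).1 :=
    fun v hv => Equiv.Perm.ofSubtype_apply_of_mem (p := fun v : Node X => v.1.Nontrivial) σ hv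
  refine ⟨Equiv.Perm.ofSubtype σ, fun v => ?_, fun v w hv hw hlt => ?_⟩
  · by_cases hv : v.1.Nontrivial
    · rw [hmem v hv]
      exact iff_of_true (σ ⟨v, hv⟩).2 hv
    · rw [Equiv.Perm.ofSubtype_apply_of_not_mem (p := fun v : Node X => v.1.Nontrivial) σ hv]
  · rw [hmem v hv, hmem w hw]
    exact hσ ⟨v, hv⟩ ⟨w, hw⟩ hlt

theorem IsLevelRelabeling.mul_swap [DecidableEq (Node X)] {π : Equiv.Perm (Node X)}
    (h : IsLevelRelabeling π) {u v : Node X} (hu : u.1.Nontrivial) (hv : v.1.Nontrivial)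
    (huv : (representingTree X).level u = (representingTree X).level v) :
    IsLevelRelabeling (π * Equiv.swap u v) := by
  have hn : ∀ w, (Equiv.swap u v w).1.Nontrivial ↔ w.1.Nontrivial := by
    intro w
    rw [Equiv.swap_apply_def]
    split_ifs with h₁ h₂
    · rw [h₁]; exact iff_of_true hv hu
    · rw [h₂]; exact iff_of_true hu hv
    · rfl
  have hl : ∀ w, (representingTree X).level (Equiv.swap u v w) = (representingTree X).level w := by
    intro w
    rw [Equiv.swap_apply_def]
    split_ifs with h₁ h₂
    · rw [h₁, huv]
    · rw [h₂, huv]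
    · rfl
  refine ⟨fun w => (h.nontrivial_iff _).trans (hn w), fun a b ha hb hab => ?_⟩
  exact h.label_lt _ _ ((hn a).2 ha) ((hn b).2 hb) (by rwa [hl, hl])

theorem IsLevelRelabeling.strictMono [Nonempty X] {π : Equiv.Perm (Node X)}
    (h : IsLevelRelabeling π) {v w : Node X} (hvw : v.1 ⊂ w.1) : label (π v) < label (π w) := by
  obtain ⟨x, hx⟩ := v.2.nonempty
  obtain ⟨y, hy, hyv⟩ := Set.exists_of_ssubset hvw
  have hw : w.1.Nontrivial := ⟨x, hvw.subset hx, y, hy, fun e => hyv (e ▸ hx)⟩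
  by_cases hv : v.1.Nontrivial
  · exact h.label_lt w v hw hv (level_lt_of_ssubset hvw)
  · rw [label_eq_zero fun hn => hv ((h.nontrivial_iff v).1 hn)]
    exact label_pos ((h.nontrivial_iff w).2 hw)

/-- The nodes containing `x` form a chain under inclusion, on which both the old and the new labels
are strictly increasing. -/
theorem IsLevelRelabeling.lt_iff [Nonempty X] {π : Equiv.Perm (Node X)} (h : IsLevelRelabeling π)
    (x y z : X) : label (π (join x y)) < label (π (join x z)) ↔ dist x y < dist x z := by
  have key : ∀ {y z : X}, dist x y < dist x z →
      label (π (join x y)) < label (π (join x z)) := by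
    intro y z hlt
    refine h.strictMono (Set.ssubset_iff_subset_ne.2 ⟨?_, fun e => hlt.ne ?_⟩)
    · refine Node.subset_of_label_le (left_mem_join x y) (left_mem_join x z) ?_
      rw [label_join, label_join]
      exact hlt.le
    · rw [← label_join x y, ← label_join x z, Subtype.ext e]
  refine ⟨fun hlt => ?_, key⟩
  by_contra hle
  rcases (not_lt.1 hle).lt_or_eq with h' | h'
  · exact hlt.not_gt (key h')
  · refine hlt.ne (congrArg (fun w => label (π w)) ?_)
    exact Node.eq_of_label_eq (left_mem_join x y) (left_mem_join x z)
      (by rw [label_join, label_join, h'])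

/-- The space with the distances prescribed by a level relabeling. -/
theorem IsLevelRelabeling.exists_space [Nonempty X] {π : Equiv.Perm (Node X)}
    (h : IsLevelRelabeling π) :
    ∃ (Y : Type u) (_ : MetricSpace Y) (_ : IsUltrametricDist Y) (ψ : X ≃ Y),
      ∀ x y, dist (ψ x) (ψ y) = label (π (join x y)) := by
  let ρ : X → X → ℝ := fun x y => label (π (join x y))
  have hself : ∀ x, ρ x x = 0 := fun x =>
    label_eq_zero fun hn => nontrivial_join_iff.1 ((h.nontrivial_iff _).1 hn) rfl
  have hcomm : ∀ x y, ρ x y = ρ y x := fun x y =>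
    congrArg (fun w => label (π w)) (join_comm x y)
  have hpos : ∀ x y, 0 ≤ ρ x y := fun x y => Metric.diam_nonneg
  have hle : ∀ {x y z}, dist x y ≤ dist x z → ρ x y ≤ ρ x z := fun {x y z} hd =>
    not_lt.1 fun hlt => hd.not_gt ((h.lt_iff x z y).1 hlt)
  have hmax : ∀ x y z, ρ x z ≤ max (ρ x y) (ρ y z) := by
    intro x y z
    -- The strong triangle inequality compares two distances from a common point, `x` or `z`, and
    -- such comparisons survive the relabeling.
    rcases le_max_iff.1 (dist_triangle_max x y z) with hd | hd
    · exact le_max_of_le_left (hle hd)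
    · refine le_max_of_le_right ?_
      rw [hcomm x z, hcomm y z]
      exact hle (by rwa [dist_comm z x, dist_comm z y])
  let m : MetricSpace X :=
    { dist := ρ
      dist_self := hself
      dist_comm := hcomm
      dist_triangle := fun x y z =>
        (hmax x y z).trans (max_le_add_of_nonneg (hpos x y) (hpos y z))
      eq_of_dist_eq_zero := fun {x y} h0 => by
        by_contra hne
        exact (label_pos ((h.nontrivial_iff _).2 (nontrivial_join_iff.2 hne))).ne' h0 }
  exact ⟨X, m, @IsUltrametricDist.mk X m.toDist hmax, Equiv.refl X, fun x y => rfl⟩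

theorem spectrum_eq_of_dist_eq_label [Nonempty X] {π : Equiv.Perm (Node X)} {Y : Type u}
    [MetricSpace Y] {ψ : X ≃ Y}
    (hψ : ∀ x y, dist (ψ x) (ψ y) = label (π (join x y))) : spectrum X = spectrum Y := by
  rw [← range_label, ← π.surjective.range_comp label]
  ext t
  constructor
  · rintro ⟨v, rfl⟩
    obtain ⟨x, hx⟩ := v.2.nonempty
    obtain ⟨y, -, rfl⟩ := exists_join_eq hx
    exact ⟨ψ x, ψ y, hψ x y⟩
  · rintro ⟨x, y, rfl⟩
    refine ⟨join (ψ.symm x) (ψ.symm y), ?_⟩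
    simp [← hψ]

/-- Two level relabelings of a tree-spectrum isometric space differ by a tree automorphism that is
induced by a permutation of the points. -/
theorem TreeSpectrumIsometric.exists_perm [Nonempty X] (hX : TreeSpectrumIsometric X)
    {π₁ π₂ : Equiv.Perm (Node X)} (h₁ : IsLevelRelabeling π₁) (h₂ : IsLevelRelabeling π₂) :
    ∃ (θ : Equiv.Perm X) (h : PreservesLocalOrder θ),
      ∀ v, label (π₂ (h.nodeEquiv v)) = label (π₁ v) := by
  have key : ∀ {π : Equiv.Perm (Node X)}, IsLevelRelabeling π →
      ∃ χ : X ≃ X, ∀ x y, dist (χ x) (χ y) = label (π (join x y)) := by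
    intro π h
    obtain ⟨Y, m, hY, ψ, hψ⟩ := h.exists_space
    have : Finite Y := Finite.of_equiv X ψ
    have : Nonempty Y := ψ.nonempty_congr.1 ‹_›
    have hloc : PreservesLocalOrder ψ := fun x y z => by rw [hψ, hψ, h.lt_iff]
    obtain ⟨φ⟩ := hX Y hloc.isomorphic (spectrum_eq_of_dist_eq_label hψ)
    exact ⟨ψ.trans φ.symm.toEquiv, fun x y => (φ.symm.dist_eq _ _).trans (hψ x y)⟩
  obtain ⟨χ₁, hχ₁⟩ := key h₁
  obtain ⟨χ₂, hχ₂⟩ := key h₂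
  have hd : ∀ x y, label (π₂ (join ((χ₁.trans χ₂.symm) x) ((χ₁.trans χ₂.symm) y))) =
      label (π₁ (join x y)) := by
    intro x y
    simp [← hχ₁, ← hχ₂]
  have hloc : PreservesLocalOrder (χ₁.trans χ₂.symm) := fun x y z => by
    rw [← h₂.lt_iff, hd, hd, h₁.lt_iff]
  refine ⟨_, hloc, fun v => ?_⟩
  obtain ⟨x, hx⟩ := v.2.nonempty
  obtain ⟨y, -, rfl⟩ := exists_join_eq hx
  rw [hloc.nodeEquiv_join, hd]

/-- In a tree-spectrum isometric space, any two internal nodes of the same level are exchanged by a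
tree automorphism that fixes all other internal nodes. -/
theorem TreeSpectrumIsometric.exists_swap [DecidableEq (Node X)] [Nonempty X]
    (hX : TreeSpectrumIsometric X)
    (hinj : InjectiveInternalLabeling X) {u v : Node X} (hu : u.1.Nontrivial) (hv : v.1.Nontrivial)
    (huv : (representingTree X).level u = (representingTree X).level v) :
    ∃ (θ : Equiv.Perm X) (h : PreservesLocalOrder θ),
      ∀ w : Node X, w.1.Nontrivial → h.nodeEquiv w = Equiv.swap u v w := by
  obtain ⟨π, hπ⟩ := exists_isLevelRelabeling hinj
  have hπ' := hπ.mul_swap hu hv huv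
  obtain ⟨θ, h, hθ⟩ := hX.exists_perm hπ hπ'
  refine ⟨θ, h, fun w hw => ?_⟩
  have hw' : (h.nodeEquiv w).1.Nontrivial := hw.image θ.injective
  -- Injectivity turns the equality of labels into an equality of nodes, from which `π` cancels.
  have := hinj (isInternal_iff.2 ((hπ'.nontrivial_iff _).2 hw'))
    (isInternal_iff.2 ((hπ.nontrivial_iff _).2 hw)) (hθ w)
  exact (Equiv.swap_apply_eq_iff.1 (π.injective this))

theorem TreeSpectrumIsometric.levelRigid [Nonempty X] (hX : TreeSpectrumIsometric X)
    (hinj : InjectiveInternalLabeling X) : (representingTree X).LevelRigid := by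
  classical
  have hheight : ∀ v w : Node X, v.1.Nontrivial → w.1.Nontrivial → v ≠ w →
      (representingTree X).level v = (representingTree X).level w →
      (representingTree X).level v + 1 = (representingTree X).height := by
    intro v w hv hw hne hl
    have hlt := level_lt_height (isInternal_iff.2 hv)
    by_contra hne'
    -- A deepest leaf `c` lies more than one level below `v`, so its ancestor `b` on the level after
    -- that of `v` is internal.
    obtain ⟨c, hc, hcl⟩ := exists_leaf_level_eq_height X
    obtain ⟨b, hb, -, hbi⟩ :=
      exists_internal_ancestor c (k := (representingTree X).level v + 1) (by omega)
    obtain ⟨a, hab⟩ := exists_parent (v := b) (by omega)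
    have hla := level_eq_add_one hab
    -- Since `v ≠ w`, one of them differs from the parent `a` of `b`. Swapping it with `a` fixes `b`
    -- and would give `b` two parents.
    obtain ⟨q, hq, hqa, hql⟩ : ∃ q : Node X, q.1.Nontrivial ∧ q ≠ a ∧
        (representingTree X).level q = (representingTree X).level v := by
      rcases eq_or_ne v a with e | e
      · exact ⟨w, hw, fun e' => hne (e.trans e'.symm), hl.symm⟩
      · exact ⟨v, hv, e, rfl⟩
    obtain ⟨θ, h, hθ⟩ := hX.exists_swap hinj (u := a) (v := q) hab.1 hq (by omega)
    have hfix : h.nodeEquiv b = b := by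
      rw [hθ b (isInternal_iff.1 hbi), Equiv.swap_apply_of_ne_of_ne]
      · rintro rfl; omega
      · rintro rfl; omega
    have hpart := (h.isPart_iff (v := a) (w := b)).2 hab
    rw [hfix, hθ a hab.1, Equiv.swap_apply_left] at hpart
    exact hqa (Subtype.ext (IsPart.parent_unique q.2 a.2 hpart hab))
  intro v w hv hw hne hl
  have hv' := isInternal_iff.1 hv
  have hw' := isInternal_iff.1 hw
  refine ⟨hheight v w hv' hw' hne hl, hheight w v hw' hv' hne.symm hl.symm, ?_⟩
  obtain ⟨θ, h, hθ⟩ := hX.exists_swap hinj hv' hw' hl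
  have hvw : h.treeIso v = w := (hθ v hv').trans (Equiv.swap_apply_left _ _)
  rw [← hvw, RTree.outDegree_map h.treeIso h.treeIso_root]

end Relabel

end UltraTree

namespace UltraTree

/-! ### Sufficiency of the level condition: counting internal nodes and leaves. -/

namespace RTree

/-- The number of children of a node that are leaves. -/
noncomputable def leafDegree (T : RTree.{u}) (v : T.V) : ℕ :=
  {w : T.V | T.IsChild v w ∧ T.IsLeaf w}.ncard

theorem leafDegree_map {T₁ T₂ : RTree.{u}} (f : T₁.graph ≃g T₂.graph) (hf : f T₁.root = T₂.root)
    (v : T₁.V) : T₂.leafDegree (f v) = T₁.leafDegree v := by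
  unfold leafDegree
  rw [← Set.ncard_image_of_injective _ f.injective]
  congr 1
  ext w
  obtain ⟨w, rfl⟩ := f.surjective w
  simp [isChild_map f hf, isLeaf_map f hf]

end RTree

/-- Two rank functions that decrease along the same real labeling and have the same distribution
of values coincide. -/
theorem eq_of_antitone_of_comp_perm {I : Type*} [Finite I] {p q : I → ℕ} {g : I → ℝ}
    (hp : ∀ a b, p a < p b → g b < g a) (hq : ∀ a b, q a < q b → g b < g a)
    (σ : Equiv.Perm I) (hσ : ∀ a, q (σ a) = p a) : p = q := by
  have key : ∀ {p q : I → ℕ}, (∀ a b, p a < p b → g b < g a) → (∀ a b, q a < q b → g b < g a) →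
      ∀ σ : Equiv.Perm I, (∀ a, q (σ a) = p a) → ∀ a, q a ≤ p a := by
    intro p q hp hq σ hσ a
    by_contra hlt
    push Not at hlt
    -- Sublevel sets of both ranks consist of the elements with largest `g`, so they are nested; as
    -- `a` lies in only one of these two, the inclusion is strict. But `σ` forces equal
    -- cardinalities.
    have hss : {b | q b ≤ p a} ⊂ {b | p b ≤ p a} := by
      refine ⟨fun b hb => ?_, fun h => ?_⟩
      · exact not_lt.1 fun h => (hp a b h).not_gt (hq b a (lt_of_le_of_lt hb hlt))
      · exact hlt.not_ge (h (a := a) (le_refl (p a)))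
    refine (Set.ncard_lt_ncard hss (Set.toFinite _)).ne ?_
    rw [← Set.ncard_image_of_injective {b | p b ≤ p a} σ.injective]
    congr 1
    ext b
    obtain ⟨b, rfl⟩ := σ.surjective b
    rw [σ.injective.mem_set_image]
    simp [hσ]
  funext a
  exact le_antisymm (key hq hp σ.symm (fun a => by rw [← hσ, σ.apply_symm_apply]) a)
    (key hp hq σ hσ a)

section Internal

variable {X : Type u} [MetricSpace X] [IsUltrametricDist X] [Finite X]

variable (X) in
/-- The internal nodes of the representing tree. -/
abbrev InternalNode : Type u := {v : Node X // v.1.Nontrivial}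

/-- The level of `v` is not the last one with internal nodes, so `v` is its only internal node and
must be the ancestor of `w` there. -/
theorem ssubset_of_level_lt_of_levelRigid [Nonempty X] (h : (representingTree X).LevelRigid)
    {v w : Node X} (hv : v.1.Nontrivial) (hw : w.1.Nontrivial)
    (hlt : (representingTree X).level v < (representingTree X).level w) : w.1 ⊂ v.1 := by
  obtain ⟨c, hc, hs, hci⟩ := exists_internal_ancestor w hlt
  have hw' := level_lt_height (isInternal_iff.2 hw)
  have : v = c := by
    by_contra hne
    have := (h v c (isInternal_iff.2 hv) hci hne hc.symm).1
    omega
  rwa [this]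

theorem label_lt_of_ssubset [Nonempty X] {v w : Node X} (h : w.1 ⊂ v.1) : label w < label v := by
  obtain ⟨x, hx⟩ := w.2.nonempty
  exact lt_of_not_ge fun hle => h.not_subset (Node.subset_of_label_le (h.subset hx) hx hle)

theorem exists_internalNode_isPart_singleton [Nontrivial X] (x : X) :
    ∃ v : InternalNode X, IsPart v.1.1 {x} := by
  have hss : (join x x).1 ⊂ (⟨Set.univ, IsNode.root⟩ : Node X).1 := by
    rw [coe_join_self, Set.ssubset_univ_iff]
    exact fun h => Set.not_nontrivial_singleton (h ▸ Set.nontrivial_univ)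
  obtain ⟨v, hv⟩ := exists_parent (v := join x x) (Nat.ne_zero_of_lt (level_lt_of_ssubset hss))
  rw [coe_join_self] at hv
  exact ⟨⟨v, hv.1⟩, hv⟩

/-- The smallest internal node that contains a given point. -/
noncomputable def pointParent [Nontrivial X] (x : X) : InternalNode X :=
  (exists_internalNode_isPart_singleton x).choose

theorem isPart_pointParent [Nontrivial X] (x : X) : IsPart (pointParent x).1.1 {x} :=
  (exists_internalNode_isPart_singleton x).choose_spec

theorem pointParent_eq_iff [Nontrivial X] {x : X} {v : InternalNode X} :
    pointParent x = v ↔ IsPart v.1.1 {x} := by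
  refine ⟨fun h => h ▸ isPart_pointParent x, fun h => Subtype.ext (Subtype.ext ?_)⟩
  exact IsPart.parent_unique (pointParent x).1.2 v.1.2 (isPart_pointParent x) h

theorem mem_pointParent [Nontrivial X] (x : X) : x ∈ (pointParent x).1.1 :=
  (isPart_pointParent x).ssubset.subset rfl

theorem pointParent_subset [Nontrivial X] {x : X} {v : InternalNode X} (hx : x ∈ v.1.1) :
    (pointParent x).1.1 ⊆ v.1.1 := by
  refine Node.subset_of_label_le (mem_pointParent x) hx ?_
  refine IsPart.label_le_of_ssubset (w := join x x) ?_ ?_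
  · rw [coe_join_self]; exact isPart_pointParent x
  · rw [coe_join_self]
    exact Set.ssubset_iff_subset_ne.2 ⟨by simpa using hx, fun e =>
      Set.not_nontrivial_singleton (e ▸ v.2)⟩

/-- Leaves are the singletons, so the leaf children of `v` are the points whose smallest internal
node is `v`. -/
theorem card_pointParent_fiber [Nontrivial X] (v : InternalNode X) :
    Nat.card {x : X // pointParent x = v} = (representingTree X).leafDegree v.1 := by
  have hinj : Function.Injective (fun x : X => join x x) := by
    intro x y h
    have := congrArg Subtype.val h
    rwa [coe_join_self, coe_join_self, Set.singleton_eq_singleton_iff] at this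
  have : {w : Node X | (representingTree X).IsChild v.1 w ∧ (representingTree X).IsLeaf w} =
      (fun x : X => join x x) '' {x | pointParent x = v} := by
    ext w
    constructor
    · rintro ⟨hc, hl⟩
      obtain ⟨x, rfl⟩ := isLeaf_iff.1 hl
      refine ⟨x, pointParent_eq_iff.2 ?_, rfl⟩
      rw [← coe_join_self]
      exact isChild_iff.1 hc
    · rintro ⟨x, hx, rfl⟩
      refine ⟨isChild_iff.2 ?_, isLeaf_join_self x⟩
      rw [coe_join_self]
      exact pointParent_eq_iff.1 hx
  refine Eq.trans ?_ (congrArg Set.ncard this).symm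
  rw [Set.ncard_image_of_injective _ hinj]
  rfl

theorem leafDegree_eq_outDegree [Nonempty X] {v : Node X}
    (h : (representingTree X).level v + 1 = (representingTree X).height) :
    (representingTree X).leafDegree v = (representingTree X).outDegree v := by
  unfold RTree.leafDegree RTree.outDegree
  congr 1
  ext w
  refine ⟨And.left, fun hw => ⟨hw, ?_⟩⟩
  by_contra hl
  have := level_lt_height (v := w) hl
  have := hw.2
  omega

variable (X) in
/-- The label of an internal node, as a nonzero element of the spectrum. -/
noncomputable def internalLabel [Nonempty X] (v : InternalNode X) : ↥(spectrum X \ {0}) :=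
  ⟨label v.1, range_label (X := X) ▸ Set.mem_range_self v.1, (label_pos v.2).ne'⟩

theorem internalLabel_surjective [Nonempty X] : Function.Surjective (internalLabel X) := by
  rintro ⟨t, ht, h0⟩
  rw [← range_label] at ht
  obtain ⟨v, rfl⟩ := ht
  refine ⟨⟨v, ?_⟩, rfl⟩
  by_contra hv
  exact h0 (label_eq_zero hv)

theorem internalLabel_injective [Nonempty X] (hinj : InjectiveInternalLabeling X) :
    Function.Injective (internalLabel X) := fun v w h => by
  have h' : (internalLabel X v : ℝ) = internalLabel X w := by rw [h]
  exact Subtype.ext (hinj (isInternal_iff.2 v.2) (isInternal_iff.2 w.2) h')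

end Internal

/-! ### Lifting a correspondence of internal nodes to an isometry. -/

section Isometry

variable {X Y : Type u} [MetricSpace X] [IsUltrametricDist X] [Finite X]
  [MetricSpace Y] [IsUltrametricDist Y] [Finite Y]

/-- `φ` sends the points of an internal node `v` into `lam v`. For `v = join x y`, the diameter of
`lam v` is `dist x y`. -/
theorem dist_map_le [Nontrivial X] [Nontrivial Y] {lam : InternalNode X → InternalNode Y}
    (hmono : ∀ v w, v.1.1 ⊆ w.1.1 → (lam v).1.1 ⊆ (lam w).1.1)
    (hlabel : ∀ v, label (lam v).1 = label v.1) {φ : X → Y}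
    (hφ : ∀ x, pointParent (φ x) = lam (pointParent x)) (x y : X) :
    dist (φ x) (φ y) ≤ dist x y := by
  rcases eq_or_ne x y with rfl | hne
  · simp
  have hmem : ∀ (v : InternalNode X) (z : X), z ∈ v.1.1 → φ z ∈ (lam v).1.1 := by
    intro v z hz
    refine hmono _ _ (pointParent_subset hz) ?_
    rw [← hφ]
    exact mem_pointParent _
  let v : InternalNode X := ⟨join x y, nontrivial_join_iff.2 hne⟩
  have h := hlabel v
  rw [label_join] at h
  rw [← h]
  exact dist_le_diam (hmem v x (left_mem_join x y)) (hmem v y (right_mem_join x y))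

/-- The correspondence of internal nodes induced by an isomorphism of representing trees. -/
def internalEquiv [Nonempty X] [Nonempty Y]
    (f : (representingTree X).graph ≃g (representingTree Y).graph)
    (hf : f (representingTree X).root = (representingTree Y).root) :
    InternalNode X ≃ InternalNode Y :=
  f.toEquiv.subtypeEquiv fun _ =>
    isInternal_iff.symm.trans ((RTree.isInternal_map f hf).symm.trans isInternal_iff)

theorem exists_labelEquiv [Nonempty X] [Nonempty Y] (hinj : InjectiveInternalLabeling X)
    (hspec : spectrum X = spectrum Y) (e : InternalNode X ≃ InternalNode Y) :
    ∃ lam : InternalNode X ≃ InternalNode Y, ∀ v, label (lam v).1 = label v.1 := by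
  let eX := Equiv.ofBijective _ ⟨internalLabel_injective hinj, internalLabel_surjective⟩
  -- Injectivity of the labels of `Y` is not assumed: it follows from surjectivity onto a set with
  -- as many elements as `Y` has internal nodes.
  have hY : Function.Bijective (internalLabel Y) := by
    refine internalLabel_surjective.bijective_of_nat_card_le ?_
    rw [← hspec, ← Nat.card_congr e, Nat.card_congr eX]
  let eY := Equiv.ofBijective _ hY
  let eS : ↥(spectrum X \ {0}) ≃ ↥(spectrum Y \ {0}) := Equiv.setCongr (by rw [hspec])
  refine ⟨eX.trans (eS.trans eY.symm), fun v => ?_⟩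
  have h : (eY (eY.symm (eS (eX v))) : ℝ) = eS (eX v) := by rw [eY.apply_symm_apply]
  exact h

theorem monotone_of_levelRigid [Nonempty X] [Nonempty Y] (hY : (representingTree Y).LevelRigid)
    {lam : InternalNode X → InternalNode Y}
    (hlevel : ∀ v, (representingTree Y).level (lam v).1 = (representingTree X).level v.1)
    (v w : InternalNode X) (h : v.1.1 ⊆ w.1.1) : (lam v).1.1 ⊆ (lam w).1.1 := by
  rcases eq_or_ne v w with rfl | hne
  · rfl
  have hss : v.1.1 ⊂ w.1.1 :=
    Set.ssubset_iff_subset_ne.2 ⟨h, fun e => hne (Subtype.ext (Subtype.ext e))⟩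
  refine (ssubset_of_level_lt_of_levelRigid hY (lam w).2 (lam v).2 ?_).subset
  rw [hlevel, hlevel]
  exact level_lt_of_ssubset hss

end Isometry

theorem treeSpectrumIsometric_of_levelRigid {X : Type u} [MetricSpace X] [IsUltrametricDist X]
    [Finite X] [Nontrivial X] (hinj : InjectiveInternalLabeling X)
    (hX : (representingTree X).LevelRigid) : TreeSpectrumIsometric X := by
  rintro Y _ _ _ _ ⟨f, hf⟩ hspec
  have hY : (representingTree Y).LevelRigid := hX.map f hf
  have : Nontrivial Y := by
    have := (RTree.isInternal_map f hf).2
      ((isInternal_iff (v := ⟨Set.univ, IsNode.root⟩)).2 Set.nontrivial_univ)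
    exact Set.nontrivial_univ_iff.1 ((isInternal_iff.1 this).mono (Set.subset_univ _))
  let e := internalEquiv f hf
  obtain ⟨lam, hlam⟩ := exists_labelEquiv hinj hspec e
  have hlevel : ∀ v, (representingTree Y).level (lam v).1 = (representingTree X).level v.1 := by
    -- Both levels, of `v` and of `lam v`, decrease along the label; `f` shows that they have the
    -- same distribution of values.
    refine fun v => (congrFun (eq_of_antitone_of_comp_perm
      (p := fun v : InternalNode X => (representingTree X).level v.1)
      (q := fun v => (representingTree Y).level (lam v).1) (g := fun v => label v.1)
      (fun a b h => label_lt_of_ssubset (ssubset_of_level_lt_of_levelRigid hX a.2 b.2 h))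
      (fun a b h => ?_) (e.trans lam.symm) fun a => ?_) v).symm
    · simp only [← hlam]
      exact label_lt_of_ssubset (ssubset_of_level_lt_of_levelRigid hY (lam a).2 (lam b).2 h)
    · simp only [Equiv.trans_apply, Equiv.apply_symm_apply]
      exact RTree.level_map f hf a.1
  have hlevel' : ∀ w, (representingTree X).level (lam.symm w).1 = (representingTree Y).level w.1 :=
    fun w => by rw [← hlevel, lam.apply_symm_apply]
  have hleaf : ∀ v, (representingTree Y).leafDegree (lam v).1 =
      (representingTree X).leafDegree v.1 := by
    intro v
    refine Eq.trans ?_ (RTree.leafDegree_map f hf v.1)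
    -- `lam v` and `f v` have the same level. If they differ, they lie on the last internal level,
    -- where all children are leaves and out-degrees agree.
    by_cases heq : (lam v).1 = f v.1
    · rw [heq]
    · obtain ⟨h₁, h₂, h₃⟩ := hY (lam v).1 (f v.1) (isInternal_iff.2 (lam v).2)
        ((RTree.isInternal_map f hf).2 (isInternal_iff.2 v.2)) heq
        ((hlevel v).trans (RTree.level_map f hf v.1).symm)
      exact (leafDegree_eq_outDegree h₁).trans (h₃.trans (leafDegree_eq_outDegree h₂).symm)
  have hcard : ∀ w, Nat.card {x : X // lam (pointParent x) = w} =
      Nat.card {y : Y // pointParent y = w} := by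
    intro w
    obtain ⟨v, rfl⟩ := lam.surjective w
    rw [card_pointParent_fiber, hleaf, ← card_pointParent_fiber]
    simp only [lam.injective.eq_iff]
  -- Fibers over each internal node have equal size, so points can be matched fiber by fiber; the
  -- choice within a fiber is immaterial.
  let φ : X ≃ Y := Equiv.ofFiberEquiv fun w => (Finite.card_eq.1 (hcard w)).some
  have hφ : ∀ x, pointParent (φ x) = lam (pointParent x) := Equiv.ofFiberEquiv_map _
  refine ⟨⟨φ, Isometry.of_dist_eq fun x y => le_antisymm ?_ ?_⟩⟩
  · exact dist_map_le (monotone_of_levelRigid hY hlevel) hlam hφ x y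
  · have := dist_map_le (φ := φ.symm) (monotone_of_levelRigid hX hlevel')
      (fun w => by rw [← hlam, lam.apply_symm_apply])
      (fun y => by rw [lam.eq_symm_apply, ← hφ, φ.apply_symm_apply]) (φ x) (φ y)
    simpa using this

end UltraTree

theorem theorem5p1 (X : Type u) [MetricSpace X] [IsUltrametricDist X] [Finite X]
    (hX : 2 ≤ Nat.card X) (hinj : UltraTree.InjectiveInternalLabeling X) :
    UltraTree.TreeSpectrumIsometric X ↔
      ∀ v w : (UltraTree.representingTree X).V,
        (UltraTree.representingTree X).IsInternal v →
        (UltraTree.representingTree X).IsInternal w →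
        v ≠ w →
        (UltraTree.representingTree X).level v = (UltraTree.representingTree X).level w →
          (UltraTree.representingTree X).level v + 1 = (UltraTree.representingTree X).height ∧
          (UltraTree.representingTree X).level w + 1 = (UltraTree.representingTree X).height ∧
          (UltraTree.representingTree X).outDegree v =
            (UltraTree.representingTree X).outDegree w := by
  have : Nontrivial X := Finite.one_lt_card_iff_nontrivial.1 hX
  exact ⟨fun h => h.levelRigid hinj, UltraTree.treeSpectrumIsometric_of_levelRigid hinj⟩
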